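/- Let $\Omega\subset\mathbb R^N$ ($N\ge 1$) be a bounded connected open set with Lipschitz boundary, let $\partial_D\Omega\subseteq\partial\Omega$ be relatively open, and let $1<p<\infty$, $q=\frac{p}{p-1}$. Let $f:\Omega\times\mathbb R^N\to\mathbb R$ be a Carathéodory function such that for a.e. $x\in\Omega$ the map $\xi\mapsto f(x,\xi)$ is strictly convex and $C^1$, $f(x,0)=0$, and $\alpha|\xi|^p\le f(x,\xi)\le\beta(|\xi|^p+1)$ for all $\xi\in\mathbb R^N$, with constants $\alpha,\beta>0$. Write $\partial f(x,\xi)$ for the gradient of $f$ in $\xi$, $f^*(x,\zeta)=\sup_{\xi\in\mathbb R^N}(\zeta\cdot\xi-f(x,\xi))$ for the convex conjugate in the second variable, and $\partial f^*(x,\zeta)$ for the gradient of $f^*$ in $\zeta$. Let $\psi\in W^{1,p}(\Omega)\cap L^\infty(\Omega)$. For a closed set $\Gamma\subseteq\overline\Omega$ let $u_\Gamma$ be a minimizer of $$\min\Big\{\int_{\Omega\setminus\Gamma} f(x,\nabla v)\,dx \,:\, v\in W^{1,p}(\Omega\setminus\Gamma),\ v=\psi\text{ on }\partial_D\Omega\setminus\Gamma\Big\},$$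 the boundary condition being understood in the sense of traces, and let $$\mathcal A(\Gamma)=\{v\in W^{1,p}(\Omega\setminus\Gamma)\,:\,v=0\text{ on }\partial_D\Omega\setminus\Gamma\}.$$ Let $u$ be the elastic solution, i.e. a minimizer for $\Gamma=\emptyset$, and let $\sigma(x)=\partial f(x,\nabla u(x))$ be its stress. **Theorem.** Let $\Gamma$ be a closed subset of $\overline\Omega$, and let $\tau\in L^q(\Omega;\mathbb R^N)$ satisfy $$\int_{\Omega\setminus\Gamma}\tau\cdot\nabla v\,dx=0\qquad\text{for all }v\in\mathcal A(\Gamma).$$ Then $f(x,\nabla u)-f(x,\nabla u_\Gamma)$ is integrable on $\Omega\setminus\Gamma$, $(\tau-\sigma)\cdot(\partial f^*(x,\tau)-\partial f^*(x,\sigma))$ is integrable on $\Omega$, and $$\int_{\Omega\setminus\Gamma}\big[f(x,\nabla u)-f(x,\nabla u_\Gamma)\big]\,dx\;\le\;\int_{\Omega\setminus\Gamma}(\tau-\sigma)\cdot\big(\partial f^*(x,\tau)-\partial f^*(x,\sigma)\big)\,dx .$$ In particular, if $\Gamma$ has Lebesgue measure zero, then $$\int_{\Omega}\big[f(x,\nabla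 u)-f(x,\nabla u_\Gamma)\big]\,dx\;\le\;\int_{\Omega}(\tau-\sigma)\cdot\big(\partial f^*(x,\tau)-\partial f^*(x,\sigma)\big)\,dx .$$ -/

import Mathlib

open MeasureTheory Set Filter Topology
open scoped ContDiff InnerProductSpace

noncomputable section

namespace BrittleCrack

/-- `Ω` has Lipschitz boundary: near each boundary point, in suitable orthogonal coordinates with
vertical direction `e`, the set `Ω` is the strict epigraph of a Lipschitz function `g` of the
horizontal component `y - ⟪e, y⟫ e`. -/
def HasLipschitzBoundary {N : ℕ} (Ω : Set (EuclideanSpace ℝ (Fin N))) : Prop :=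
  ∀ x₀ ∈ frontier Ω, ∃ e : EuclideanSpace ℝ (Fin N), ‖e‖ = 1 ∧
    ∃ (K : NNReal) (g : EuclideanSpace ℝ (Fin N) → ℝ), LipschitzWith K g ∧
      ∃ r > (0 : ℝ), ∀ y ∈ Metric.ball x₀ r,
        (y ∈ Ω ↔ g (y - ⟪e, y⟫_ℝ • e) < ⟪e, y⟫_ℝ)

/-- `D` is a relatively open subset of the boundary of `Ω`. -/
def IsRelOpenBoundaryPart {N : ℕ} (Ω D : Set (EuclideanSpace ℝ (Fin N))) : Prop :=
  ∃ O : Set (EuclideanSpace ℝ (Fin N)), IsOpen O ∧ D = O ∩ frontier Ω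

/-- `G` is the weak (distributional) gradient of `v` in the open set `U`, tested with smooth
functions with compact support in `U`. -/
def IsWeakGradient {N : ℕ} (U : Set (EuclideanSpace ℝ (Fin N)))
    (v : EuclideanSpace ℝ (Fin N) → ℝ)
    (G : EuclideanSpace ℝ (Fin N) → EuclideanSpace ℝ (Fin N)) : Prop :=
  ∀ φ : EuclideanSpace ℝ (Fin N) → ℝ, ContDiff ℝ ∞ φ → HasCompactSupport φ → tsupport φ ⊆ U →
    ∀ i : Fin N,
      ∫ x in U, v x * fderiv ℝ φ x (EuclideanSpace.single i 1) = -∫ x in U, G x i * φ x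

/-- `v ∈ W^{1,p}(U)`, with weak gradient `∇v = G` (unique up to null sets). -/
structure IsSobolev {N : ℕ} (p : ℝ) (U : Set (EuclideanSpace ℝ (Fin N)))
    (v : EuclideanSpace ℝ (Fin N) → ℝ)
    (G : EuclideanSpace ℝ (Fin N) → EuclideanSpace ℝ (Fin N)) : Prop where
  memLp : MemLp v (ENNReal.ofReal p) (volume.restrict U)
  memLp_grad : MemLp G (ENNReal.ofReal p) (volume.restrict U)
  isWeakGradient : IsWeakGradient U v G

/-- The trace on the boundary of `Ω` of the function `v` takes the value `a` at `x`:
`r^{-N} ∫_{B_r(x) ∩ Ω} |v(y) - a| dy → 0` as `r → 0+`. -/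
def HasTraceAt {N : ℕ} (Ω : Set (EuclideanSpace ℝ (Fin N)))
    (v : EuclideanSpace ℝ (Fin N) → ℝ) (x : EuclideanSpace ℝ (Fin N)) (a : ℝ) : Prop :=
  Tendsto (fun r : ℝ => (r ^ N)⁻¹ * ∫ y in Metric.ball x r ∩ Ω, |v y - a|) (𝓝[>] 0) (𝓝 0)

/-- `v = w` on the part `S` of the boundary of `Ω`, in the sense of traces: at almost every point
of `S` with respect to the `(N-1)`-dimensional Hausdorff measure, `v` and `w` have a trace and the
two traces coincide. -/
def TraceEqOn {N : ℕ} (Ω S : Set (EuclideanSpace ℝ (Fin N)))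
    (v w : EuclideanSpace ℝ (Fin N) → ℝ) : Prop :=
  ∀ᵐ x ∂(Measure.hausdorffMeasure ((N : ℝ) - 1) : Measure (EuclideanSpace ℝ (Fin N))),
    x ∈ S → ∃ a : ℝ, HasTraceAt Ω v x a ∧ HasTraceAt Ω w x a

/-- `v` is an admissible displacement, with gradient `G`, for the crack `Γ` and the boundary datum
`ψ` on the Dirichlet part `D`: `v ∈ W^{1,p}(Ω \ Γ)` and `v = ψ` on `D \ Γ`.
For `ψ = 0` this is the space of admissible variations `A(Γ)`. -/
structure IsAdmissible {N : ℕ} (p : ℝ) (Ω D Γ : Set (EuclideanSpace ℝ (Fin N)))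
    (ψ v : EuclideanSpace ℝ (Fin N) → ℝ)
    (G : EuclideanSpace ℝ (Fin N) → EuclideanSpace ℝ (Fin N)) : Prop where
  isSobolev : IsSobolev p (Ω \ Γ) v G
  traceEqOn : TraceEqOn Ω (D \ Γ) v ψ

/-- `u`, with gradient `Du`, minimizes the bulk energy `∫ f(x, ∇v) dx` among the admissible
displacements for the crack `Γ` and the boundary datum `ψ`. -/
structure IsMinimizer {N : ℕ} (p : ℝ)
    (f : EuclideanSpace ℝ (Fin N) → EuclideanSpace ℝ (Fin N) → ℝ)
    (Ω D Γ : Set (EuclideanSpace ℝ (Fin N))) (ψ u : EuclideanSpace ℝ (Fin N) → ℝ)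
    (Du : EuclideanSpace ℝ (Fin N) → EuclideanSpace ℝ (Fin N)) : Prop where
  isAdmissible : IsAdmissible p Ω D Γ ψ u Du
  le : ∀ v G, IsAdmissible p Ω D Γ ψ v G →
    ∫ x in Ω \ Γ, f x (Du x) ≤ ∫ x in Ω \ Γ, f x (G x)

/-- The elastic solution: a minimizer for the body without crack. -/
def IsElasticSolution {N : ℕ} (p : ℝ)
    (f : EuclideanSpace ℝ (Fin N) → EuclideanSpace ℝ (Fin N) → ℝ)
    (Ω D : Set (EuclideanSpace ℝ (Fin N))) (ψ u : EuclideanSpace ℝ (Fin N) → ℝ)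
    (Du : EuclideanSpace ℝ (Fin N) → EuclideanSpace ℝ (Fin N)) : Prop :=
  IsMinimizer p f Ω D ∅ ψ u Du

/-- The assumptions on the bulk energy density `f : Ω × ℝ^N → ℝ`: a Carathéodory function,
strictly convex and `C¹` in the second variable, vanishing at `ξ = 0`, with `p`-growth. -/
structure IsBulkDensity {N : ℕ} (p : ℝ) (Ω : Set (EuclideanSpace ℝ (Fin N)))
    (f : EuclideanSpace ℝ (Fin N) → EuclideanSpace ℝ (Fin N) → ℝ) : Prop where
  aemeasurable : ∀ ξ, AEMeasurable (fun x => f x ξ) (volume.restrict Ω)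
  continuous : ∀ᵐ x ∂(volume.restrict Ω), Continuous (f x)
  strictConvex : ∀ᵐ x ∂(volume.restrict Ω), StrictConvexOn ℝ univ (f x)
  contDiff : ∀ᵐ x ∂(volume.restrict Ω), ContDiff ℝ 1 (f x)
  map_zero : ∀ᵐ x ∂(volume.restrict Ω), f x 0 = 0
  growth : ∃ α > (0 : ℝ), ∃ β > (0 : ℝ), ∀ᵐ x ∂(volume.restrict Ω), ∀ ξ,
    α * ‖ξ‖ ^ p ≤ f x ξ ∧ f x ξ ≤ β * (‖ξ‖ ^ p + 1)

/-- The convex conjugate `f^*(x, ζ) = sup_ξ (ζ · ξ - f(x, ξ))` with respect to the second variable.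
The supremum is finite for almost every `x` when `f` has `p`-growth from below with `p > 1`. -/
def conjugate {N : ℕ} (f : EuclideanSpace ℝ (Fin N) → EuclideanSpace ℝ (Fin N) → ℝ)
    (x ζ : EuclideanSpace ℝ (Fin N)) : ℝ :=
  ⨆ ξ : EuclideanSpace ℝ (Fin N), (⟪ζ, ξ⟫_ℝ - f x ξ)

/-- The stress `σ(x) = ∂f(x, ∇u(x))` associated with the displacement gradient `Du = ∇u`. -/
def stress {N : ℕ} (f : EuclideanSpace ℝ (Fin N) → EuclideanSpace ℝ (Fin N) → ℝ)
    (Du : EuclideanSpace ℝ (Fin N) → EuclideanSpace ℝ (Fin N)) (x : EuclideanSpace ℝ (Fin N)) :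
    EuclideanSpace ℝ (Fin N) :=
  gradient (f x) (Du x)

/-- The integrand `(τ - σ) · (∂f^*(x, τ) - ∂f^*(x, σ))` at the point `x`. -/
def dualIntegrand {N : ℕ} (f : EuclideanSpace ℝ (Fin N) → EuclideanSpace ℝ (Fin N) → ℝ)
    (σ τ : EuclideanSpace ℝ (Fin N) → EuclideanSpace ℝ (Fin N)) (x : EuclideanSpace ℝ (Fin N)) :
    ℝ :=
  ⟪τ x - σ x, gradient (conjugate f x) (τ x) - gradient (conjugate f x) (σ x)⟫_ℝ

end BrittleCrack

end

open BrittleCrack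

/-! ### Convex functions, their conjugates, and growth bounds -/

section ConvexAnalysis

variable {E : Type*} [NormedAddCommGroup E] [InnerProductSpace ℝ E]

/-! Fix `x` and write `G = ∇u`, `H = ∇u_Γ`, `σ = ∂f(G)`, `g = ∂f*(τ)`. Since `g` maximizes `τ·ξ -
f(ξ)`, comparison with `H` gives `τ·H - f(H) ≤ τ·g - f(g)`; the tangent at `G` gives `f(G) + σ·(g -
G) ≤ f(g)`. Adding, and using `G = ∂f*(σ)`, yields `f(G) - f(H) ≤ (τ - σ)·(∂f*(τ) - ∂f*(σ)) + τ·(G -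
H)` (`IsBulkDensity.sub_le_dualIntegrand`). The last term integrates to zero because `u - u_Γ` lies
in `A(Γ)` (`IsAdmissible.sub_elastic`).

The rest justifies this: `f*` is differentiable with the maximizer as gradient
(`IsConjugateMaximizer.hasGradientAt`), and `p`-growth puts `∂f(∇u)` in `L^q` and `∂f*(τ)` in `L^p`,
so Hölder makes all products integrable. -/

lemma ConvexOn.add_inner_gradient_le [CompleteSpace E] {F : E → ℝ} {g ξ : E}
    (hF : ConvexOn ℝ univ F) (hg : HasGradientAt F g ξ) (η : E) :
    F ξ + ⟪g, η - ξ⟫_ℝ ≤ F η := by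
  have h1 : ConvexOn ℝ univ (F ∘ AffineMap.lineMap (k := ℝ) ξ η) := by
    simpa using hF.comp_affineMap (AffineMap.lineMap (k := ℝ) ξ η)
  have h2 : HasDerivAt (F ∘ AffineMap.lineMap (k := ℝ) ξ η) ⟪g, η - ξ⟫_ℝ 0 := by
    have h3 : HasFDerivAt F (InnerProductSpace.toDual ℝ E g)
        (AffineMap.lineMap (k := ℝ) ξ η (0 : ℝ)) := by
      simpa using hg.hasFDerivAt
    simpa using h3.comp_hasDerivAt (0 : ℝ) AffineMap.hasDerivAt_lineMap
  have h3 := h1.le_slope_of_hasDerivAt (mem_univ 0) (mem_univ 1) zero_lt_one h2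
  simp only [slope, sub_zero, inv_one, Function.comp_apply, AffineMap.lineMap_apply_one,
    AffineMap.lineMap_apply_zero, vsub_eq_sub, one_smul] at h3
  linarith

/-- `G` realizes the supremum defining the convex conjugate of `F` at `ζ`. -/
def IsConjugateMaximizer (F : E → ℝ) (ζ G : E) : Prop :=
  ∀ ξ, ⟪ζ, ξ⟫_ℝ - F ξ ≤ ⟪ζ, G⟫_ℝ - F G

lemma IsConjugateMaximizer.iSup_eq {F : E → ℝ} {ζ G : E} (h : IsConjugateMaximizer F ζ G) :
    ⨆ ξ, (⟪ζ, ξ⟫_ℝ - F ξ) = ⟪ζ, G⟫_ℝ - F G :=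
  le_antisymm (ciSup_le h) (le_ciSup (f := fun ξ => ⟪ζ, ξ⟫_ℝ - F ξ) ⟨_, forall_mem_range.2 h⟩ G)

/-- By strict convexity, the midpoint of two distinct maximizers would do strictly better. -/
lemma IsConjugateMaximizer.unique {F : E → ℝ} (hF : StrictConvexOn ℝ univ F) {ζ G G' : E}
    (h : IsConjugateMaximizer F ζ G) (h' : IsConjugateMaximizer F ζ G') : G = G' := by
  by_contra hne
  have h1 := hF.2 (mem_univ G) (mem_univ G') hne (by norm_num : (0 : ℝ) < 1 / 2)
    (by norm_num : (0 : ℝ) < 1 / 2) (by norm_num)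
  have h2 := h ((1 / 2 : ℝ) • G + (1 / 2 : ℝ) • G')
  have h3 := h' G
  rw [inner_add_right, inner_smul_right, inner_smul_right] at h2
  simp only [smul_eq_mul] at h1
  linarith

/-- The tangent inequality rearranged; with uniqueness of maximizers it yields `∂f*(∂f(ξ)) = ξ`. -/
lemma isConjugateMaximizer_of_hasGradientAt [CompleteSpace E] {F : E → ℝ} {g ξ : E}
    (hF : ConvexOn ℝ univ F) (hg : HasGradientAt F g ξ) : IsConjugateMaximizer F g ξ := by
  intro η
  have := hF.add_inner_gradient_le hg η
  rw [inner_sub_right] at this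
  linarith

section Coercive

variable {F : E → ℝ} {α p : ℝ}

/-- Cauchy–Schwarz, then cancel one factor `‖G‖`. The radius serves both for compactness of
maximizers and for the `L^p` bound on `∂f*(τ)`. -/
lemma norm_le_of_mul_rpow_le_inner (hp : 1 < p) (hα : 0 < α) {ζ G : E}
    (h : α * ‖G‖ ^ p ≤ ⟪ζ, G⟫_ℝ) : ‖G‖ ≤ (‖ζ‖ / α) ^ (1 / (p - 1)) := by
  rcases (norm_nonneg G).eq_or_lt with h0 | h0
  · rw [← h0]; positivity
  have h1 : α * ‖G‖ ^ (p - 1) * ‖G‖ ≤ ‖ζ‖ * ‖G‖ := by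
    rw [mul_assoc, ← Real.rpow_add_one h0.ne', sub_add_cancel]
    exact h.trans (real_inner_le_norm ζ G)
  have h2 : ‖G‖ ^ (p - 1) ≤ ‖ζ‖ / α := by
    rw [le_div_iff₀ hα, mul_comm]
    exact le_of_mul_le_mul_right h1 h0
  have h3 : 0 < p - 1 := by linarith
  calc ‖G‖ = (‖G‖ ^ (p - 1)) ^ (1 / (p - 1)) := by
        rw [← Real.rpow_mul h0.le, mul_one_div_cancel h3.ne', Real.rpow_one]
    _ ≤ _ := Real.rpow_le_rpow (by positivity) h2 (by positivity)

lemma IsConjugateMaximizer.norm_le (hp : 1 < p) (hα : 0 < α) (h0 : F 0 = 0)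
    (hF : ∀ ξ, α * ‖ξ‖ ^ p ≤ F ξ) {ζ G : E} (h : IsConjugateMaximizer F ζ G) :
    ‖G‖ ≤ (‖ζ‖ / α) ^ (1 / (p - 1)) := by
  refine norm_le_of_mul_rpow_le_inner hp hα ?_
  have h1 := h 0
  rw [inner_zero_right, h0] at h1
  linarith [hF G]

variable [FiniteDimensional ℝ E]

lemma exists_isConjugateMaximizer (hp : 1 < p) (hα : 0 < α) (h0 : F 0 = 0)
    (hF : ∀ ξ, α * ‖ξ‖ ^ p ≤ F ξ) (hc : Continuous F) (ζ : E) :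
    ∃ G, IsConjugateMaximizer F ζ G := by
  obtain ⟨G, -, hG⟩ := (isCompact_closedBall (0 : E) ((‖ζ‖ / α) ^ (1 / (p - 1)))).exists_isMaxOn
    ⟨0, Metric.mem_closedBall_self (by positivity)⟩
    (f := fun ξ => ⟪ζ, ξ⟫_ℝ - F ξ) (by fun_prop)
  refine ⟨G, fun ξ => ?_⟩
  by_cases hξ : ‖ξ‖ ≤ (‖ζ‖ / α) ^ (1 / (p - 1))
  · exact hG (by simpa using hξ)
  -- Outside the ball the objective is negative, hence below its value `0` at the origin.
  · have h1 := hG (Metric.mem_closedBall_self (by positivity) :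
      (0 : E) ∈ Metric.closedBall 0 ((‖ζ‖ / α) ^ (1 / (p - 1))))
    simp only [mem_ofPred_eq, inner_zero_right, h0, sub_zero] at h1
    have h2 : ¬ α * ‖ξ‖ ^ p ≤ ⟪ζ, ξ⟫_ℝ := fun h => hξ (norm_le_of_mul_rpow_le_inner hp hα h)
    linarith [hF ξ]

/-- The conjugate of a strictly convex function with superlinear growth is differentiable, and its
gradient is the point realizing the supremum. -/
lemma IsConjugateMaximizer.hasGradientAt (hp : 1 < p) (hα : 0 < α) (h0 : F 0 = 0)
    (hF : ∀ ξ, α * ‖ξ‖ ^ p ≤ F ξ) (hc : Continuous F) (hs : StrictConvexOn ℝ univ F) {ζ G : E}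
    (hG : IsConjugateMaximizer F ζ G) :
    HasGradientAt (fun ζ => ⨆ ξ, (⟪ζ, ξ⟫_ℝ - F ξ)) G ζ := by
  choose S hS using exists_isConjugateMaximizer hp hα h0 hF hc
  have hSG : S ζ = G := (hS ζ).unique hs hG
  have hp' : 0 < p - 1 := by linarith
  -- Maximizers for nearby `z` stay in a fixed compact ball, and any cluster point is again a
  -- maximizer at `ζ`, hence equals `G`.
  have hlim : Tendsto S (𝓝 ζ) (𝓝 G) := by
    refine (isCompact_closedBall (0 : E)
      (((‖ζ‖ + 1) / α) ^ (1 / (p - 1)))).tendsto_nhds_of_unique_mapClusterPt ?_ ?_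
    · have : ∀ᶠ z in 𝓝 ζ, ‖z‖ < ‖ζ‖ + 1 :=
        continuous_norm.continuousAt.eventually_lt continuousAt_const (by simp)
      filter_upwards [this] with z hz
      rw [mem_closedBall_zero_iff]
      refine ((hS z).norm_le hp hα h0 hF).trans ?_
      gcongr
    · intro y _ hy
      obtain ⟨U, hU, hUy⟩ := mapClusterPt_iff_ultrafilter.1 hy
      refine IsConjugateMaximizer.unique hs (fun ξ => ?_) hG
      have hid : Tendsto (fun z : E => z) U (𝓝 ζ) := hU
      have h1 : Tendsto (fun z => ⟪z, ξ⟫_ℝ - F ξ) U (𝓝 (⟪ζ, ξ⟫_ℝ - F ξ)) :=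
        (hid.inner tendsto_const_nhds).sub_const _
      have h2 : Tendsto (fun z => ⟪z, S z⟫_ℝ - F (S z)) U (𝓝 (⟪ζ, y⟫_ℝ - F y)) :=
        (hid.inner hUy).sub ((hc.tendsto y).comp hUy)
      exact le_of_tendsto_of_tendsto' h1 h2 fun z => hS z ξ
  rw [hasGradientAt_iff_isLittleO, Asymptotics.isLittleO_iff]
  intro c hcpos
  have hev : ∀ᶠ z in 𝓝 ζ, ‖S z - G‖ < c := by
    have := (hlim.sub_const G).norm
    rw [sub_self, norm_zero] at this
    exact this.eventually (gt_mem_nhds hcpos)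
  filter_upwards [hev] with z hz
  rw [(hS z).iSup_eq, hG.iSup_eq]
  -- Testing each maximizer against the other's problem squeezes the first-order remainder between
  -- `0` and `⟪S z - G, z - ζ⟫`.
  have h1 := hS z G
  have h2 := hG (S z)
  have h3 : ⟪S z - G, z - ζ⟫_ℝ ≤ c * ‖z - ζ‖ :=
    (real_inner_le_norm _ _).trans (by gcongr)
  simp only [inner_sub_left, inner_sub_right] at h3 ⊢
  rw [real_inner_comm z (S z), real_inner_comm ζ (S z)] at h3
  rw [real_inner_comm z G, real_inner_comm ζ G] at h3 ⊢
  rw [Real.norm_eq_abs, abs_le]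
  constructor <;> linarith [mul_nonneg hcpos.le (norm_nonneg (z - ζ))]

end Coercive

lemma norm_gradient_le_of_growth [CompleteSpace E] {F : E → ℝ} {β p : ℝ} (hp : 1 < p) (hβ : 0 < β)
    (hF : ConvexOn ℝ univ F) (hnn : ∀ ξ, 0 ≤ F ξ) (hle : ∀ ξ, F ξ ≤ β * (‖ξ‖ ^ p + 1))
    {g ξ : E} (hg : HasGradientAt F g ξ) :
    ‖g‖ ≤ β * (2 ^ p + 1) * (‖ξ‖ + 1) ^ (p - 1) := by
  rcases (norm_nonneg g).eq_or_lt with h0 | h0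
  · rw [← h0]; positivity
  have hξ := norm_nonneg ξ
  set t : ℝ := ‖ξ‖ + 1 with ht
  have htpos : 0 < t := by positivity
  -- Moving a distance `‖ξ‖ + 1` along `g` raises the tangent by `‖g‖ * t`, while `F η` is only of
  -- order `t ^ p`.
  set η : E := ξ + (t / ‖g‖) • g with hη
  have h1 := hF.add_inner_gradient_le hg η
  have h2 : ⟪g, η - ξ⟫_ℝ = ‖g‖ * t := by
    rw [hη, add_sub_cancel_left, inner_smul_right, real_inner_self_eq_norm_sq]
    field_simp
  have h3 : ‖η‖ ≤ 2 * t := by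
    refine (norm_add_le _ _).trans ?_
    rw [norm_smul, Real.norm_of_nonneg (by positivity), div_mul_cancel₀ _ h0.ne']
    linarith
  have h4 : F η ≤ β * (2 ^ p + 1) * t ^ p := by
    refine (hle η).trans ?_
    have h5 : ‖η‖ ^ p ≤ 2 ^ p * t ^ p := by
      rw [← Real.mul_rpow (by norm_num) htpos.le]
      exact Real.rpow_le_rpow (norm_nonneg _) h3 (by linarith)
    have h6 : 1 ≤ t ^ p := Real.one_le_rpow (by linarith) (by linarith)
    rw [mul_assoc]
    gcongr
    linarith
  have h7 : ‖g‖ * t ≤ β * (2 ^ p + 1) * t ^ (p - 1) * t := by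
    rw [mul_assoc _ _ t, ← Real.rpow_add_one htpos.ne', sub_add_cancel]
    linarith [hnn ξ]
  exact le_of_mul_le_mul_right h7 htpos

end ConvexAnalysis

/-! ### Measurability of superpositions and Hölder pairing -/

section Caratheodory

variable {X E : Type*} [MeasurableSpace X] {μ : Measure X}

/-- Superposition of a Carathéodory function with a measurable function. -/
lemma aemeasurable_caratheodory_comp [TopologicalSpace E] {F : X → E → ℝ}
    (hm : ∀ ξ, AEMeasurable (fun x => F x ξ) μ) (hc : ∀ᵐ x ∂μ, Continuous (F x)) {w : X → E}
    (hw : AEStronglyMeasurable w μ) : AEMeasurable (fun x => F x (w x)) μ := by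
  obtain ⟨w', hw', hww'⟩ := hw
  have key : AEMeasurable (fun x => F x (w' x)) μ := by
    refine aemeasurable_of_tendsto_metrizable_ae atTop (f := fun n x => F x (hw'.approx n x))
      (fun n => ?_) ?_
    -- A simple function takes finitely many values, so the exceptional null sets of the slices `F ·
    -- ξ` can be united.
    · refine ⟨fun x => (hm (hw'.approx n x)).mk _ x,
        (hw'.approx n).measurable_bind _ fun ξ => (hm ξ).measurable_mk, ?_⟩
      have : ∀ᵐ x ∂μ, ∀ ξ ∈ (hw'.approx n).range, F x ξ = (hm ξ).mk _ x :=
        (ae_ball_iff (hw'.approx n).range.countable_toSet).2 fun ξ _ => (hm ξ).ae_eq_mk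
      filter_upwards [this] with x hx
      exact hx _ ((hw'.approx n).mem_range_self x)
    · filter_upwards [hc] with x hx
      exact (hx.tendsto _).comp (hw'.tendsto_approx x)
  refine key.congr ?_
  filter_upwards [hww'] with x hx
  rw [hx]

/-- Each coordinate is an a.e. limit of difference quotients, which are measurable superpositions.
-/
lemma aestronglyMeasurable_gradient_comp {N : ℕ} {F : X → EuclideanSpace ℝ (Fin N) → ℝ}
    (hm : ∀ ξ, AEMeasurable (fun x => F x ξ) μ) (hd : ∀ᵐ x ∂μ, Differentiable ℝ (F x))
    {w : X → EuclideanSpace ℝ (Fin N)} (hw : AEStronglyMeasurable w μ) :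
    AEStronglyMeasurable (fun x => gradient (F x) (w x)) μ := by
  have hc : ∀ᵐ x ∂μ, Continuous (F x) := hd.mono fun x hx => hx.continuous
  have hcoord : ∀ i, AEMeasurable (fun x => gradient (F x) (w x) i) μ := by
    intro i
    set e : EuclideanSpace ℝ (Fin N) := EuclideanSpace.single i 1 with he
    refine aemeasurable_of_tendsto_metrizable_ae (𝓝[≠] (0 : ℝ))
      (f := fun t x => t⁻¹ • (F x (w x + t • e) - F x (w x))) (fun t => ?_) ?_
    · exact ((aemeasurable_caratheodory_comp hm hc (hw.add_const _)).sub
        (aemeasurable_caratheodory_comp hm hc hw)).const_mul _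
    · filter_upwards [hd] with x hx
      have h1 := ((hx (w x)).hasGradientAt.hasFDerivAt.hasLineDerivAt e).tendsto_slope_zero
      rw [InnerProductSpace.toDual_apply_apply, he, EuclideanSpace.inner_single_right] at h1
      simpa using h1
  have : AEMeasurable (fun x => WithLp.ofLp (gradient (F x) (w x))) μ :=
    aemeasurable_pi_lambda _ hcoord
  exact ((PiLp.continuous_toLp 2 _).measurable.comp_aemeasurable this).aestronglyMeasurable

end Caratheodory

lemma MeasureTheory.MemLp.integrable_inner_of_conjExponent {N : ℕ} {p : ℝ} {X : Type*} [MeasurableSpace X]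
    {μ : Measure X} (hp : 1 < p) {s g : X → EuclideanSpace ℝ (Fin N)}
    (hs : MemLp s (ENNReal.ofReal (p / (p - 1))) μ) (hg : MemLp g (ENNReal.ofReal p) μ) :
    Integrable (fun x => ⟪s x, g x⟫_ℝ) μ := by
  have hpq : (p / (p - 1)).HolderConjugate p := (Real.HolderConjugate.conjExponent hp).symm
  have : (ENNReal.ofReal (p / (p - 1))).HolderTriple (ENNReal.ofReal p) 1 := by
    exact hpq.ennrealOfReal
  refine (hs.norm.integrable_mul hg.norm).mono
    (hs.aestronglyMeasurable.inner hg.aestronglyMeasurable) (ae_of_all _ fun x => ?_)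
  simpa using abs_real_inner_le_norm (s x) (g x)

namespace BrittleCrack

variable {N : ℕ}

/-! ### Sobolev functions, traces, and admissible variations -/

section Sobolev

lemma IsWeakGradient.mono {U V : Set (EuclideanSpace ℝ (Fin N))} (hU : IsOpen U) (hVU : V ⊆ U)
    {v : EuclideanSpace ℝ (Fin N) → ℝ} {G : EuclideanSpace ℝ (Fin N) → EuclideanSpace ℝ (Fin N)}
    (h : IsWeakGradient U v G) : IsWeakGradient V v G := by
  intro φ hφ hc hs i
  have h0 : ∀ x, x ∉ V → φ x = 0 := fun x hx => image_eq_zero_of_notMem_tsupport fun h => hx (hs h)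
  have h1 : ∀ x, x ∉ V → fderiv ℝ φ x = 0 := fun x hx =>
    image_eq_zero_of_notMem_tsupport fun h => hx (hs (tsupport_fderiv_subset ℝ h))
  have := h φ hφ hc (hs.trans hVU) i
  rwa [setIntegral_eq_of_subset_of_forall_sdiff_eq_zero hU.measurableSet hVU,
    setIntegral_eq_of_subset_of_forall_sdiff_eq_zero hU.measurableSet hVU] at this
  · intro x hx
    rw [h0 x hx.2, mul_zero]
  · intro x hx
    rw [h1 x hx.2, zero_apply, mul_zero]

lemma IsSobolev.mono {p : ℝ} {U V : Set (EuclideanSpace ℝ (Fin N))} (hU : IsOpen U) (hVU : V ⊆ U)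
    {v : EuclideanSpace ℝ (Fin N) → ℝ} {G : EuclideanSpace ℝ (Fin N) → EuclideanSpace ℝ (Fin N)}
    (h : IsSobolev p U v G) : IsSobolev p V v G where
  memLp := h.memLp.mono_measure (Measure.restrict_mono hVU le_rfl)
  memLp_grad := h.memLp_grad.mono_measure (Measure.restrict_mono hVU le_rfl)
  isWeakGradient := h.isWeakGradient.mono hU hVU

lemma IsSobolev.sub {p : ℝ} (hp : 1 ≤ p) {U : Set (EuclideanSpace ℝ (Fin N))}
    (hU : volume U ≠ ⊤) {v w : EuclideanSpace ℝ (Fin N) → ℝ}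
    {G H : EuclideanSpace ℝ (Fin N) → EuclideanSpace ℝ (Fin N)}
    (hv : IsSobolev p U v G) (hw : IsSobolev p U w H) : IsSobolev p U (v - w) (G - H) where
  memLp := hv.memLp.sub hw.memLp
  memLp_grad := hv.memLp_grad.sub hw.memLp_grad
  isWeakGradient := by
    intro φ hφ hc hs i
    have : IsFiniteMeasure (volume.restrict U) := isFiniteMeasure_restrict.2 hU
    have hp' : 1 ≤ ENNReal.ofReal p := by simpa using ENNReal.ofReal_le_ofReal hp
    have hφc := hφ.continuous
    have hdφc : Continuous fun x => fderiv ℝ φ x (EuclideanSpace.single i 1) :=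
      (hφ.continuous_fderiv (by simp)).clm_apply continuous_const
    obtain ⟨C, hC⟩ := hc.exists_bound_of_continuous hφc
    obtain ⟨C', hC'⟩ := (hc.fderiv_apply ℝ (EuclideanSpace.single i 1)).exists_bound_of_continuous
      hdφc
    have h1 : ∀ {v : EuclideanSpace ℝ (Fin N) → ℝ}, MemLp v (ENNReal.ofReal p) (volume.restrict U) →
        IntegrableOn (fun x => v x * fderiv ℝ φ x (EuclideanSpace.single i 1)) U := fun hv =>
      (hv.integrable hp').mul_bdd hdφc.aestronglyMeasurable (ae_of_all _ hC')
    have h2 : ∀ {G : EuclideanSpace ℝ (Fin N) → EuclideanSpace ℝ (Fin N)},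
        MemLp G (ENNReal.ofReal p) (volume.restrict U) →
        IntegrableOn (fun x => G x i * φ x) U := fun hG =>
      ((EuclideanSpace.proj (𝕜 := ℝ) i).integrable_comp (hG.integrable hp')).mul_bdd
        hφc.aestronglyMeasurable (ae_of_all _ hC)
    simp only [Pi.sub_apply, PiLp.sub_apply, sub_mul]
    rw [integral_sub (h1 hv.memLp) (h1 hw.memLp), integral_sub (h2 hv.memLp_grad)
      (h2 hw.memLp_grad), hv.isWeakGradient φ hφ hc hs i, hw.isWeakGradient φ hφ hc hs i]
    ring

lemma HasTraceAt.zero (Ω : Set (EuclideanSpace ℝ (Fin N))) (x : EuclideanSpace ℝ (Fin N)) :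
    HasTraceAt Ω 0 x 0 := by
  simp [HasTraceAt]

/-- Two functions having a trace in common with a third one differ by a function with zero trace.
The two trace values are not compared, so no regularity of `Ω` is needed. -/
lemma HasTraceAt.sub_of_common {Ω : Set (EuclideanSpace ℝ (Fin N))}
    {v w ψ : EuclideanSpace ℝ (Fin N) → ℝ} {x : EuclideanSpace ℝ (Fin N)} {a b : ℝ}
    (hv : HasTraceAt Ω v x a) (hψa : HasTraceAt Ω ψ x a) (hw : HasTraceAt Ω w x b)
    (hψb : HasTraceAt Ω ψ x b) {ρ : ℝ} (hρ : 0 < ρ)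
    (hvi : IntegrableOn v (Metric.ball x ρ ∩ Ω)) (hwi : IntegrableOn w (Metric.ball x ρ ∩ Ω))
    (hψi : IntegrableOn ψ (Metric.ball x ρ ∩ Ω)) : HasTraceAt Ω (v - w) x 0 := by
  -- Uses `v - w = (v - a) - (ψ - a) + (ψ - b) - (w - b)` and the triangle inequality.
  have hlim := ((hv.add hψa).add hψb).add hw
  simp only [add_zero] at hlim
  refine squeeze_zero' ?_ ?_ hlim
  · filter_upwards [self_mem_nhdsWithin] with r hr
    have hr : 0 < r := hr
    have : 0 ≤ ∫ y in Metric.ball x r ∩ Ω, |(v - w) y - 0| := integral_nonneg fun _ => abs_nonneg _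
    positivity
  · filter_upwards [self_mem_nhdsWithin, nhdsWithin_le_nhds (gt_mem_nhds hρ)] with r hr hrρ
    have hr : 0 < r := hr
    have hsub : Metric.ball x r ∩ Ω ⊆ Metric.ball x ρ ∩ Ω :=
      inter_subset_inter_left _ (Metric.ball_subset_ball hrρ.le)
    have hfin : volume (Metric.ball x r ∩ Ω) ≠ ⊤ :=
      ((measure_mono inter_subset_left).trans_lt measure_ball_lt_top).ne
    have hI : ∀ {g : EuclideanSpace ℝ (Fin N) → ℝ} (c : ℝ), IntegrableOn g (Metric.ball x ρ ∩ Ω) →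
        IntegrableOn (fun y => |g y - c|) (Metric.ball x r ∩ Ω) := fun c hg =>
      ((hg.mono_set hsub).sub (integrableOn_const hfin)).abs
    have h2 : IntegrableOn (fun y => |v y - a| + |ψ y - a|) (Metric.ball x r ∩ Ω) :=
      (hI a hvi).add (hI a hψi)
    have h3 : IntegrableOn (fun y => |v y - a| + |ψ y - a| + |ψ y - b|) (Metric.ball x r ∩ Ω) :=
      h2.add (hI b hψi)
    rw [← mul_add, ← mul_add, ← mul_add, ← integral_add (hI a hvi) (hI a hψi),
      ← integral_add h2 (hI b hψi), ← integral_add h3 (hI b hwi)]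
    refine mul_le_mul_of_nonneg_left (integral_mono ?_ ?_ fun y => ?_) (by positivity)
    · exact (((hvi.sub hwi).mono_set hsub).sub (integrableOn_const hfin)).abs
    · exact h3.add (hI b hwi)
    · simp only [Pi.sub_apply, sub_zero]
      have h1 := abs_le.1 (le_refl |v y - a|)
      have h2 := abs_le.1 (le_refl |ψ y - a|)
      have h3 := abs_le.1 (le_refl |ψ y - b|)
      have h4 := abs_le.1 (le_refl |w y - b|)
      rw [abs_le]
      constructor <;> linarith

lemma IsAdmissible.sub_elastic {p : ℝ} (hp : 1 ≤ p) {Ω D Γ : Set (EuclideanSpace ℝ (Fin N))}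
    (hΩ_open : IsOpen Ω) (hΩ_bdd : Bornology.IsBounded Ω) (hΓ : IsClosed Γ)
    {ψ u w : EuclideanSpace ℝ (Fin N) → ℝ}
    {G H Dψ : EuclideanSpace ℝ (Fin N) → EuclideanSpace ℝ (Fin N)}
    (hψ : IsSobolev p Ω ψ Dψ) (hu : IsAdmissible p Ω D ∅ ψ u G) (hw : IsAdmissible p Ω D Γ ψ w H) :
    IsAdmissible p Ω D Γ 0 (u - w) (G - H) := by
  have huS : IsSobolev p Ω u G := by simpa using hu.isSobolev
  have huT : TraceEqOn Ω D u ψ := by simpa using hu.traceEqOn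
  have hfin : volume (Ω \ Γ) ≠ ⊤ := ((measure_mono sdiff_subset).trans_lt hΩ_bdd.measure_lt_top).ne
  have : IsFiniteMeasure (volume.restrict (Ω \ Γ)) := isFiniteMeasure_restrict.2 hfin
  have hp' : 1 ≤ ENNReal.ofReal p := by simpa using ENNReal.ofReal_le_ofReal hp
  have huS' := huS.mono hΩ_open (sdiff_subset (t := Γ))
  refine ⟨huS'.sub hp hfin hw.isSobolev, ?_⟩
  filter_upwards [huT, hw.traceEqOn] with x hx hx' hxD
  obtain ⟨a, ha, ha'⟩ := hx hxD.1
  obtain ⟨b, hb, hb'⟩ := hx' hxD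
  -- Since `Γ` is closed, a small ball around `x` misses it, so membership in `L^p(Ω \ Γ)` gives
  -- integrability near `x`.
  obtain ⟨ρ, hρ, hball⟩ := Metric.isOpen_iff.1 hΓ.isOpen_compl x hxD.2
  have hsub : Metric.ball x ρ ∩ Ω ⊆ Ω \ Γ := fun y hy => ⟨hy.2, hball hy.1⟩
  have hI : ∀ {g : EuclideanSpace ℝ (Fin N) → ℝ},
      MemLp g (ENNReal.ofReal p) (volume.restrict (Ω \ Γ)) →
      IntegrableOn g (Metric.ball x ρ ∩ Ω) := fun hg =>
    IntegrableOn.mono_set (hg.integrable hp') hsub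
  exact ⟨0, ha.sub_of_common ha' hb hb' hρ (hI huS'.memLp) (hI hw.isSobolev.memLp)
    (hI (hψ.mono hΩ_open sdiff_subset).memLp), HasTraceAt.zero Ω x⟩

end Sobolev

/-! ### Integrability and duality for the bulk density -/

section BulkDensity

variable {p : ℝ} {Ω : Set (EuclideanSpace ℝ (Fin N))}
  {f : EuclideanSpace ℝ (Fin N) → EuclideanSpace ℝ (Fin N) → ℝ}

lemma IsBulkDensity.mono {V : Set (EuclideanSpace ℝ (Fin N))} (hf : IsBulkDensity p Ω f)
    (hV : V ⊆ Ω) : IsBulkDensity p V f where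
  aemeasurable ξ := (hf.aemeasurable ξ).mono_set hV
  continuous := ae_restrict_of_ae_restrict_of_subset hV hf.continuous
  strictConvex := ae_restrict_of_ae_restrict_of_subset hV hf.strictConvex
  contDiff := ae_restrict_of_ae_restrict_of_subset hV hf.contDiff
  map_zero := ae_restrict_of_ae_restrict_of_subset hV hf.map_zero
  growth := by
    obtain ⟨α, hα, β, hβ, h⟩ := hf.growth
    exact ⟨α, hα, β, hβ, ae_restrict_of_ae_restrict_of_subset hV h⟩

lemma IsBulkDensity.integrableOn_comp (hf : IsBulkDensity p Ω f) (hp : 1 < p)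
    (hΩ : volume Ω ≠ ⊤) {G : EuclideanSpace ℝ (Fin N) → EuclideanSpace ℝ (Fin N)}
    (hG : MemLp G (ENNReal.ofReal p) (volume.restrict Ω)) :
    IntegrableOn (fun x => f x (G x)) Ω := by
  obtain ⟨α, hα, β, hβ, hgr⟩ := hf.growth
  have h1 : IntegrableOn (fun x => ‖G x‖ ^ p) Ω := by
    have := hG.integrable_norm_rpow (by simp; linarith) ENNReal.ofReal_ne_top
    rwa [ENNReal.toReal_ofReal (by linarith)] at this
  refine ((h1.add (integrableOn_const hΩ (C := (1 : ℝ)))).const_mul β).mono'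
    (aemeasurable_caratheodory_comp hf.aemeasurable hf.continuous
      hG.aestronglyMeasurable).aestronglyMeasurable ?_
  filter_upwards [hgr] with x hx
  rw [Real.norm_of_nonneg (le_trans (by positivity) (hx (G x)).1)]
  exact (hx (G x)).2

lemma IsBulkDensity.hasGradientAt (hf : IsBulkDensity p Ω f) :
    ∀ᵐ x ∂(volume.restrict Ω), ∀ ξ, HasGradientAt (f x) (gradient (f x) ξ) ξ := by
  filter_upwards [hf.contDiff] with x hx ξ
  exact (hx.differentiable one_ne_zero ξ).hasGradientAt

/-- `∂f` grows with exponent `p - 1`, which carries `L^p` into `L^{p/(p-1)}`. -/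
lemma IsBulkDensity.memLp_stress (hf : IsBulkDensity p Ω f) (hp : 1 < p)
    (hΩ : volume Ω ≠ ⊤) {G : EuclideanSpace ℝ (Fin N) → EuclideanSpace ℝ (Fin N)}
    (hG : MemLp G (ENNReal.ofReal p) (volume.restrict Ω)) :
    MemLp (stress f G) (ENNReal.ofReal (p / (p - 1))) (volume.restrict Ω) := by
  have : IsFiniteMeasure (volume.restrict Ω) := isFiniteMeasure_restrict.2 hΩ
  obtain ⟨α, hα, β, hβ, hgr⟩ := hf.growth
  have hp' : 0 < p - 1 := by linarith
  have h1 := ((hG.norm.add (memLp_const (1 : ℝ))).norm_rpow_div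
    (ENNReal.ofReal (p - 1))).const_mul (β * (2 ^ p + 1))
  rw [← ENNReal.ofReal_div_of_pos hp', ENNReal.toReal_ofReal hp'.le] at h1
  refine h1.mono' (aestronglyMeasurable_gradient_comp hf.aemeasurable
    (hf.contDiff.mono fun x hx => hx.differentiable one_ne_zero) hG.aestronglyMeasurable) ?_
  filter_upwards [hgr, hf.strictConvex, hf.hasGradientAt] with x hx hc hg
  have h2 := norm_gradient_le_of_growth hp hβ hc.convexOn
    (fun ξ => le_trans (by positivity) (hx ξ).1) (fun ξ => (hx ξ).2) (hg (G x))
  rwa [Pi.add_apply, Real.norm_of_nonneg (add_nonneg (norm_nonneg _) zero_le_one)]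

lemma IsBulkDensity.isConjugateMaximizer_gradient_conjugate (hf : IsBulkDensity p Ω f)
    (hp : 1 < p) :
    ∀ᵐ x ∂(volume.restrict Ω), ∀ ζ, HasGradientAt (conjugate f x) (gradient (conjugate f x) ζ) ζ ∧
      IsConjugateMaximizer (f x) ζ (gradient (conjugate f x) ζ) := by
  obtain ⟨α, hα, β, hβ, hgr⟩ := hf.growth
  filter_upwards [hgr, hf.strictConvex, hf.continuous, hf.map_zero] with x hx hs hc h0 ζ
  obtain ⟨G, hG⟩ := exists_isConjugateMaximizer hp hα h0 (fun ξ => (hx ξ).1) hc ζ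
  have h1 : HasGradientAt (conjugate f x) G ζ :=
    hG.hasGradientAt hp hα h0 (fun ξ => (hx ξ).1) hc hs
  rw [h1.gradient]
  exact ⟨h1, hG⟩

lemma IsBulkDensity.aemeasurable_conjugate (hf : IsBulkDensity p Ω f) (hp : 1 < p)
    (ζ : EuclideanSpace ℝ (Fin N)) :
    AEMeasurable (fun x => conjugate f x ζ) (volume.restrict Ω) := by
  obtain ⟨S, hS, hSd⟩ := TopologicalSpace.exists_countable_dense (EuclideanSpace ℝ (Fin N))
  have := hS.to_subtype
  have h1 : AEMeasurable (fun x => ⨆ ξ : S, (⟪ζ, (ξ : EuclideanSpace ℝ (Fin N))⟫_ℝ - f x ξ))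
      (volume.restrict Ω) :=
    AEMeasurable.iSup fun ξ => (hf.aemeasurable ξ).const_sub _
  refine h1.congr ?_
  filter_upwards [hf.continuous, hf.isConjugateMaximizer_gradient_conjugate hp] with x hc hx
  -- By continuity of `f x`, a countable dense set of `ξ` gives the same supremum.
  exact hSd.ciSup (f := fun ξ => ⟪ζ, ξ⟫_ℝ - f x ξ) (by fun_prop)
    ⟨_, forall_mem_range.2 (hx ζ).2⟩

/-- The maximizer at `τ` is bounded by `(‖τ‖ / α) ^ (1 / (p - 1))`, whose `p`-th power is a multiple
of `‖τ‖ ^ (p / (p - 1))`. -/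
lemma IsBulkDensity.memLp_gradient_conjugate (hf : IsBulkDensity p Ω f) (hp : 1 < p)
    {τ : EuclideanSpace ℝ (Fin N) → EuclideanSpace ℝ (Fin N)}
    (hτ : MemLp τ (ENNReal.ofReal (p / (p - 1))) (volume.restrict Ω)) :
    MemLp (fun x => gradient (conjugate f x) (τ x)) (ENNReal.ofReal p) (volume.restrict Ω) := by
  obtain ⟨α, hα, β, hβ, hgr⟩ := hf.growth
  have hp' : 0 < p - 1 := by linarith
  have h1 := (hτ.const_smul α⁻¹).norm_rpow_div (ENNReal.ofReal (1 / (p - 1)))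
  rw [← ENNReal.ofReal_div_of_pos (by positivity), ENNReal.toReal_ofReal (by positivity),
    show p / (p - 1) / (1 / (p - 1)) = p by field_simp] at h1
  refine h1.mono' (aestronglyMeasurable_gradient_comp (hf.aemeasurable_conjugate hp)
    ((hf.isConjugateMaximizer_gradient_conjugate hp).mono fun x hx ζ =>
      (hx ζ).1.differentiableAt) hτ.aestronglyMeasurable) ?_
  filter_upwards [hgr, hf.map_zero, hf.isConjugateMaximizer_gradient_conjugate hp] with x hx h0 hm
  refine ((hm (τ x)).2.norm_le hp hα h0 fun ξ => (hx ξ).1).trans_eq ?_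
  simp [norm_smul, abs_of_pos hα, div_eq_inv_mul]

lemma IsBulkDensity.integrableOn_dualIntegrand (hf : IsBulkDensity p Ω f) (hp : 1 < p)
    {σ τ : EuclideanSpace ℝ (Fin N) → EuclideanSpace ℝ (Fin N)}
    (hσ : MemLp σ (ENNReal.ofReal (p / (p - 1))) (volume.restrict Ω))
    (hτ : MemLp τ (ENNReal.ofReal (p / (p - 1))) (volume.restrict Ω)) :
    IntegrableOn (dualIntegrand f σ τ) Ω :=
  (hτ.sub hσ).integrable_inner_of_conjExponent hp
    ((hf.memLp_gradient_conjugate hp hτ).sub (hf.memLp_gradient_conjugate hp hσ))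

/-- The pointwise duality estimate. -/
lemma IsBulkDensity.sub_le_dualIntegrand (hf : IsBulkDensity p Ω f) (hp : 1 < p)
    (G H τ : EuclideanSpace ℝ (Fin N) → EuclideanSpace ℝ (Fin N)) :
    ∀ᵐ x ∂(volume.restrict Ω), f x (G x) - f x (H x) ≤
      dualIntegrand f (stress f G) τ x + ⟪τ x, G x - H x⟫_ℝ := by
  filter_upwards [hf.strictConvex, hf.hasGradientAt,
    hf.isConjugateMaximizer_gradient_conjugate hp] with x hs hg hm
  have hG : gradient (conjugate f x) (stress f G x) = G x :=
    (hm _).2.unique hs (isConjugateMaximizer_of_hasGradientAt hs.convexOn (hg (G x)))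
  have h1 := (hm (τ x)).2 (H x)
  have h2 := hs.convexOn.add_inner_gradient_le (hg (G x)) (gradient (conjugate f x) (τ x))
  rw [dualIntegrand, hG]
  change f x (G x) + ⟪stress f G x, _⟫_ℝ ≤ _ at h2
  simp only [inner_sub_left, inner_sub_right] at h2 ⊢
  linarith

end BulkDensity

end BrittleCrack

/-! ### Integration of the pointwise estimate -/

theorem theorem2p1 {N : ℕ} (hN : 1 ≤ N) {p : ℝ} (hp : 1 < p)
    {Ω D : Set (EuclideanSpace ℝ (Fin N))}
    (hΩ_open : IsOpen Ω) (hΩ_conn : IsConnected Ω) (hΩ_bdd : Bornology.IsBounded Ω)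
    (hΩ_lip : HasLipschitzBoundary Ω) (hD : IsRelOpenBoundaryPart Ω D)
    {f : EuclideanSpace ℝ (Fin N) → EuclideanSpace ℝ (Fin N) → ℝ} (hf : IsBulkDensity p Ω f)
    {ψ : EuclideanSpace ℝ (Fin N) → ℝ}
    {Dψ : EuclideanSpace ℝ (Fin N) → EuclideanSpace ℝ (Fin N)}
    (hψ : IsSobolev p Ω ψ Dψ) (hψ_bdd : MemLp ψ ⊤ (volume.restrict Ω))
    {Γ : Set (EuclideanSpace ℝ (Fin N))} (hΓ_closed : IsClosed Γ) (hΓ_sub : Γ ⊆ closure Ω)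
    {u : EuclideanSpace ℝ (Fin N) → ℝ}
    {Du : EuclideanSpace ℝ (Fin N) → EuclideanSpace ℝ (Fin N)}
    (hu : IsElasticSolution p f Ω D ψ u Du)
    {uΓ : EuclideanSpace ℝ (Fin N) → ℝ}
    {DuΓ : EuclideanSpace ℝ (Fin N) → EuclideanSpace ℝ (Fin N)}
    (huΓ : IsMinimizer p f Ω D Γ ψ uΓ DuΓ)
    {τ : EuclideanSpace ℝ (Fin N) → EuclideanSpace ℝ (Fin N)}
    (hτ : MemLp τ (ENNReal.ofReal (p / (p - 1))) (volume.restrict Ω))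
    (hτ_div : ∀ (v : EuclideanSpace ℝ (Fin N) → ℝ)
      (Dv : EuclideanSpace ℝ (Fin N) → EuclideanSpace ℝ (Fin N)),
      IsAdmissible p Ω D Γ 0 v Dv → ∫ x in Ω \ Γ, inner ℝ (τ x) (Dv x) = 0) :
    IntegrableOn (fun x => f x (Du x) - f x (DuΓ x)) (Ω \ Γ) ∧
    IntegrableOn (dualIntegrand f (stress f Du) τ) Ω ∧
    ∫ x in Ω \ Γ, (f x (Du x) - f x (DuΓ x)) ≤
      ∫ x in Ω \ Γ, dualIntegrand f (stress f Du) τ x ∧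
    (volume Γ = 0 →
      ∫ x in Ω, (f x (Du x) - f x (DuΓ x)) ≤ ∫ x in Ω, dualIntegrand f (stress f Du) τ x) := by
  have hsub : Ω \ Γ ⊆ Ω := sdiff_subset
  have hΩ : volume Ω ≠ ⊤ := hΩ_bdd.measure_lt_top.ne
  have hΩΓ : volume (Ω \ Γ) ≠ ⊤ := ((measure_mono hsub).trans_lt hΩ_bdd.measure_lt_top).ne
  have hle : volume.restrict (Ω \ Γ) ≤ volume.restrict Ω := Measure.restrict_mono hsub le_rfl
  have hDu : MemLp Du (ENNReal.ofReal p) (volume.restrict Ω) := by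
    simpa using hu.isAdmissible.isSobolev.memLp_grad
  have hDuΓ := huΓ.isAdmissible.isSobolev.memLp_grad
  have hfΓ := hf.mono hsub
  have hadm := hu.isAdmissible.sub_elastic hp.le hΩ_open hΩ_bdd hΓ_closed hψ huΓ.isAdmissible
  have hint : IntegrableOn (fun x => f x (Du x) - f x (DuΓ x)) (Ω \ Γ) :=
    (hfΓ.integrableOn_comp hp hΩΓ (hDu.mono_measure hle)).sub
      (hfΓ.integrableOn_comp hp hΩΓ hDuΓ)
  have hdual : IntegrableOn (dualIntegrand f (stress f Du) τ) Ω :=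
    hf.integrableOn_dualIntegrand hp (hf.memLp_stress hp hΩ hDu) hτ
  have hcross : IntegrableOn (fun x => ⟪τ x, Du x - DuΓ x⟫_ℝ) (Ω \ Γ) :=
    (hτ.mono_measure hle).integrable_inner_of_conjExponent hp hadm.isSobolev.memLp_grad
  -- The variation `u - u_Γ` has zero trace on `D \ Γ`, so it may be tested against `τ`.
  have hzero : ∫ x in Ω \ Γ, ⟪τ x, Du x - DuΓ x⟫_ℝ = 0 := hτ_div _ _ hadm
  have hmain : ∫ x in Ω \ Γ, (f x (Du x) - f x (DuΓ x)) ≤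
      ∫ x in Ω \ Γ, dualIntegrand f (stress f Du) τ x := by
    refine (integral_mono_ae hint ((hdual.mono_set hsub).add hcross)
      (hfΓ.sub_le_dualIntegrand hp Du DuΓ τ)).trans_eq ?_
    rw [integral_add' (hdual.mono_set hsub) hcross, hzero, add_zero]
  refine ⟨hint, hdual, hmain, fun hΓ0 => ?_⟩
  have hae : (Ω \ Γ : Set (EuclideanSpace ℝ (Fin N))) =ᵐ[volume] Ω := sdiff_null_ae_eq_self hΓ0
  rwa [setIntegral_congr_set hae, setIntegral_congr_set hae] at hmain
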